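/- Let $k$ be a finite field and let $\mathcal C$ be a left homologically finite $k$-additive triangulated category with shift functor $[1]$, that is: $\operatorname{Hom}(X,Y)$ is a finite dimensional $k$-space for all objects $X,Y$; $\operatorname{End}X$ is a local ring for every indecomposable $X$; and $\sum_{i\ge 0}\dim_k\operatorname{Hom}(X[i],Y)<\infty$ for all $X,Y$. Composition is written from left to right: $fg$ is $f:X\to Y$ followed by $g:Y\to Z$. Write $\operatorname{Hom}(X,Y)_Z$ for the set of morphisms $X\to Y$ whose mapping cone is isomorphic to $Z$, and put $$\{X,Y\}:=\prod_{i>0}|\operatorname{Hom}(X[i],Y)|^{(-1)^i}.$$ Let $\mathcal H^{Dr}(\mathcal C)$ be the $\mathbb Q$-vector space with basis $\{v_{[X]}\}$ indexed by the isomorphism classes of objects of $\mathcal C$, with the bilinear multiplication determined by the finite sums $$v_{[X]}*v_{[Y]}=\{Y,X[1]\}\cdot\sum_{[L]}|\operatorname{Hom}(Y,X[1])_{L[1]}|\,v_{[L]}.$$ (1) The algebra $\mathcal H^{Dr}(\mathcal C)$ is associative. (2) Let $X\xrightarrow{f}L\xrightarrow{g}Y\xrightarrow{h}X[1]$ be a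 distinguished triangle and let $Z,L'$ be objects of $\mathcal C$. Composition with $f$ is a well-defined and surjective map $$f_*:\{n\in\operatorname{Hom}(L,Z[1]) : fn\in\operatorname{Hom}(X,Z[1])_{L'[1]}\}\longrightarrow\{n'\in\operatorname{Hom}(X,Z[1])_{L'[1]} : h\,n'[1]=0\},\qquad n\mapsto fn,$$ and every fibre of it has cardinality $$|\operatorname{Hom}(Y,Z[1])|\cdot\{X\oplus Y,Z[1]\}\cdot\{L,Z[1]\}^{-1}.$$ -/

import Mathlib

open CategoryTheory CategoryTheory.Limits CategoryTheory.Pretriangulated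

noncomputable section

namespace DrinfeldHall

universe w v u

/-- A left homologically finite `k`-additive triangulated category: finite dimensional Hom spaces,
local endomorphism rings of indecomposable objects, and, for all `X` and `Y`,
`∑_{i ≥ 0} dim_k Hom(X[i], Y) < ∞`, i.e. only finitely many of these dimensions are nonzero. -/
class LeftHomologicallyFinite (k : Type w) [Field k] (C : Type u) [Category.{v} C]
    [HasZeroObject C] [HasShift C ℤ] [Preadditive C] [Linear k C]
    [∀ n : ℤ, (shiftFunctor C n).Additive] [Pretriangulated C] : Prop where
  finite_hom : ∀ X Y : C, Module.Finite k (X ⟶ Y)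
  local_end : ∀ X : C, Indecomposable X → IsLocalRing (End X)
  finite_shift : ∀ X Y : C,
    (Function.support fun i : ℕ => Module.finrank k (X⟦(i : ℤ)⟧ ⟶ Y)).Finite

/-- The set of isomorphism classes `[X]` of objects of `C`. -/
abbrev IsoClass (C : Type u) [Category.{v} C] : Type u := Quotient (isIsomorphicSetoid C)

/-- The isomorphism class `[X]`. -/
abbrev isoClass {C : Type u} [Category.{v} C] (X : C) : IsoClass C :=
  Quotient.mk (isIsomorphicSetoid C) X

section

variable {C : Type u} [Category.{v} C] [HasShift C ℤ]

/-- `{X, Y} = ∏_{i > 0} |Hom(X[i], Y)| ^ ((-1) ^ i)`, the factor of index `i + 1` being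
written for `i : ℕ`. -/
def brace (X Y : C) : ℚ :=
  ∏ᶠ i : ℕ, (Nat.card (X⟦(i : ℤ) + 1⟧ ⟶ Y) : ℚ) ^ ((-1 : ℤ) ^ (i + 1))

theorem brace_congr {X X' Y Y' : C} (e : X ≅ X') (e' : Y ≅ Y') : brace X Y = brace X' Y' := by
  unfold brace
  refine finprod_congr fun i => ?_
  rw [Nat.card_congr (((shiftFunctor C ((i : ℤ) + 1)).mapIso e).homCongr e')]

variable [HasZeroObject C] [Preadditive C] [∀ n : ℤ, (shiftFunctor C n).Additive]
  [Pretriangulated C]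

/-- `Hom(X, Y)_Z`: the morphisms `X ⟶ Y` whose mapping cone is isomorphic to `Z`. -/
def homCone (X Y Z : C) : Set (X ⟶ Y) :=
  {f | ∃ (g : Y ⟶ Z) (h : Z ⟶ X⟦(1 : ℤ)⟧), Triangle.mk f g h ∈ distTriang C}

/-- `h_L^{XY} = |Hom(Y, X[1])_{L[1]}| * {Y, X[1]}`. -/
def coeff (X Y L : C) : ℚ :=
  (Nat.card (homCone Y (X⟦(1 : ℤ)⟧) (L⟦(1 : ℤ)⟧)) : ℚ) * brace Y (X⟦(1 : ℤ)⟧)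

theorem homCone_mem {X X' Y Y' Z Z' : C} (e : X ≅ X') (e' : Y ≅ Y') (e'' : Z ≅ Z')
    {f : X ⟶ Y} (hf : f ∈ homCone X Y Z) : e.homCongr e' f ∈ homCone X' Y' Z' := by
  obtain ⟨g, h, H⟩ := hf
  refine ⟨e'.inv ≫ g ≫ e''.hom, e''.inv ≫ h ≫ e.hom⟦(1 : ℤ)⟧', ?_⟩
  refine isomorphic_distinguished _ H _ (Triangle.isoMk _ _ e.symm e'.symm e''.symm ?_ ?_ ?_)
  · change (e.inv ≫ f ≫ e'.hom) ≫ e'.inv = e.inv ≫ f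
    simp
  · change (e'.inv ≫ g ≫ e''.hom) ≫ e''.inv = e'.inv ≫ g
    simp
  · change (e''.inv ≫ h ≫ e.hom⟦(1 : ℤ)⟧') ≫ e.inv⟦(1 : ℤ)⟧' = e''.inv ≫ h
    have he : e.hom⟦(1 : ℤ)⟧' ≫ e.inv⟦(1 : ℤ)⟧' = 𝟙 (X⟦(1 : ℤ)⟧) :=
      ((shiftFunctor C (1 : ℤ)).mapIso e).hom_inv_id
    rw [Category.assoc, Category.assoc, he, Category.comp_id]

theorem card_homCone_congr {X X' Y Y' Z Z' : C} (e : X ≅ X') (e' : Y ≅ Y') (e'' : Z ≅ Z') :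
    Nat.card (homCone X Y Z) = Nat.card (homCone X' Y' Z') := by
  refine Nat.card_congr ((e.homCongr e').subtypeEquiv fun f => ⟨homCone_mem e e' e'', fun hf => ?_⟩)
  have := homCone_mem e.symm e'.symm e''.symm hf
  simpa using this

theorem coeff_congr {X X' Y Y' L L' : C} (e : X ≅ X') (e' : Y ≅ Y') (e'' : L ≅ L') :
    coeff X Y L = coeff X' Y' L' := by
  unfold coeff
  rw [card_homCone_congr e' ((shiftFunctor C (1 : ℤ)).mapIso e)
    ((shiftFunctor C (1 : ℤ)).mapIso e''), brace_congr e' ((shiftFunctor C (1 : ℤ)).mapIso e)]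

/-- `[L] ↦ h_L^{XY}` as a function on isomorphism classes. -/
def coeffFun (X Y : C) : IsoClass C → ℚ :=
  Quotient.lift (coeff X Y) fun _ _ ⟨e⟩ => coeff_congr (Iso.refl X) (Iso.refl Y) e

theorem coeffFun_support_finite (k : Type w) [Field k] [Finite k] [Linear k C]
    [LeftHomologicallyFinite k C] (X Y : C) : (Function.support (coeffFun X Y)).Finite := by
  have : Module.Finite k (Y ⟶ X⟦(1 : ℤ)⟧) := LeftHomologicallyFinite.finite_hom _ _
  have : Finite (Y ⟶ X⟦(1 : ℤ)⟧) := Module.finite_of_finite k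
  have key : ∀ c : IsoClass C, c ∈ Function.support (coeffFun X Y) →
      ∃ (f : Y ⟶ X⟦(1 : ℤ)⟧) (L : C), isoClass L = c ∧
        f ∈ homCone Y (X⟦(1 : ℤ)⟧) (L⟦(1 : ℤ)⟧) := by
    intro c
    induction c using Quotient.inductionOn with
    | h L =>
      intro hc
      have hc' : coeff X Y L ≠ 0 := hc
      have h0 : Nat.card (homCone Y (X⟦(1 : ℤ)⟧) (L⟦(1 : ℤ)⟧)) ≠ 0 := by
        intro h0
        exact hc' (by simp [coeff, h0])
      obtain ⟨⟨⟨f, hf⟩⟩, _⟩ := Nat.card_ne_zero.1 h0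
      exact ⟨f, L, rfl, hf⟩
  choose F hF using key
  suffices Function.Injective
      fun c : Function.support (coeffFun X Y) => F c.1 c.2 from
    Set.finite_coe_iff.1 (Finite.of_injective _ this)
  rintro ⟨c, hc⟩ ⟨d, hd⟩ hcd
  change F c hc = F d hd at hcd
  obtain ⟨L, rfl, g, h, H⟩ := hF c hc
  obtain ⟨L', rfl, g', h', H'⟩ := hF d hd
  rw [Subtype.mk.injEq]
  let e := isoTriangleOfIso₁₂ _ _ H H' (Iso.refl _) (Iso.refl _)
    ((Category.comp_id _).trans (hcd.trans (Category.id_comp _).symm))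
  exact Quotient.sound ⟨(shiftFunctor C (1 : ℤ)).preimageIso (Triangle.π₃.mapIso e)⟩

end

section

variable (k : Type w) [Field k] [Finite k] (C : Type u) [Category.{v} C]
  [HasZeroObject C] [HasShift C ℤ] [Preadditive C] [Linear k C]
  [∀ n : ℤ, (shiftFunctor C n).Additive] [Pretriangulated C] [LeftHomologicallyFinite k C]

/-- The underlying `ℚ`-vector space of `H^{Dr}(C)`, with basis `v_{[X]} = Finsupp.single [X] 1`. -/
abbrev Space (C : Type u) [Category.{v} C] : Type u := IsoClass C →₀ ℚ

variable {C}

/-- `v_{[X]} * v_{[Y]} = ∑_{[L]} h_L^{XY} v_{[L]}` for objects `X` and `Y`. -/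
def objMul (X Y : C) : Space C :=
  Finsupp.ofSupportFinite (coeffFun X Y) (coeffFun_support_finite k X Y)

theorem objMul_congr {X X' Y Y' : C} (e : X ≅ X') (e' : Y ≅ Y') :
    objMul k X Y = objMul k X' Y' := by
  ext c
  induction c using Quotient.inductionOn with
  | h L => exact coeff_congr e e' (Iso.refl L)

/-- `v_x * v_y` for isomorphism classes `x` and `y`. -/
def basisMul (x y : IsoClass C) : Space C :=
  Quotient.liftOn₂ x y (objMul k) fun _ _ _ _ ⟨e⟩ ⟨e'⟩ => objMul_congr k e e'

variable (C)

/-- The multiplication of `H^{Dr}(C)`: the `ℚ`-bilinear extension of `v_x * v_y`. -/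
def mul : Space C →ₗ[ℚ] Space C →ₗ[ℚ] Space C :=
  Finsupp.linearCombination ℚ fun x : IsoClass C =>
    Finsupp.linearCombination ℚ fun y : IsoClass C => basisMul k x y

/-- `v_{[X]} * v_{[Y]} = ∑_{[L]} h_L^{XY} v_{[L]}`, coefficient by coefficient. -/
theorem mul_single_apply (X Y L : C) :
    mul k C (Finsupp.single (isoClass X) 1) (Finsupp.single (isoClass Y) 1) (isoClass L) =
      coeff X Y L := by
  simp only [mul, Finsupp.linearCombination_single, one_smul]
  rfl

end

end DrinfeldHall

end

/-! Associativity is checked pair by pair. Completing `m : Y ⟶ X[1]` to a triangle on `L` and `l : Z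
⟶ Y[1]` to a triangle `Y → A → Z`, with maps `u`, `v`, rewrites both products as sums over pairs
`(m, l)`. On one side the lifts `a : Z ⟶ L[1]` of `l` with cone `M[1]` are counted, on the other the
extensions `n : A ⟶ X[1]` of `m` along `u` with that cone. By the octahedral axiom each `n` fits,
with some `a`, into a homotopy cartesian square, so `n` and `a` have the same cone. The group
`Hom(Z, X[1])` acts transitively on lifts and on extensions, compatibly with these squares
(`exists_lift_extension`), so each cone occurs in the same proportion on both sides
(`card_orbit_mul_card_range`). The orbit sizes are orders of images in long exact sequences that
vanish far to the left; telescoping expresses them by braces (`preCard_eq`, `postCard_eq`), and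
these account exactly for the brace factors in the product. Part (2) uses the same tools: exactness
gives surjectivity, and a fibre is a coset of the image of `Hom(Y, Z[1])`. -/

noncomputable section

namespace DrinfeldHall

/-! ### Homotopy cartesian squares and cones -/

section Triangulated

variable {C : Type*} [Category C] [HasZeroObject C] [HasShift C ℤ] [Preadditive C]
  [∀ n : ℤ, (shiftFunctor C n).Additive] [Pretriangulated C]

theorem distinguished_of_iso {X Y Z X' Y' Z' : C} {f : X ⟶ Y} {g : Y ⟶ Z} {h : Z ⟶ X⟦(1 : ℤ)⟧}
    {f' : X' ⟶ Y'} {g' : Y' ⟶ Z'} {h' : Z' ⟶ X'⟦(1 : ℤ)⟧}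
    (T : Triangle.mk f g h ∈ distTriang C) (e₁ : X' ≅ X) (e₂ : Y' ≅ Y) (e₃ : Z' ≅ Z)
    (w₁ : f' ≫ e₂.hom = e₁.hom ≫ f) (w₂ : g' ≫ e₃.hom = e₂.hom ≫ g)
    (w₃ : h' ≫ e₁.hom⟦(1 : ℤ)⟧' = e₃.hom ≫ h) : Triangle.mk f' g' h' ∈ distTriang C :=
  isomorphic_distinguished _ T _ (Triangle.isoMk _ _ e₁ e₂ e₃ w₁ w₂ w₃)

theorem rotate_distinguished_iff {X Y Z : C} {f : X ⟶ Y} {g : Y ⟶ Z} {h : Z ⟶ X⟦(1 : ℤ)⟧} :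
    Triangle.mk f g h ∈ distTriang C ↔ Triangle.mk g h (-f⟦(1 : ℤ)⟧') ∈ distTriang C :=
  rotate_distinguished_triangle _

/-- The automorphism `-1` of an object. -/
def negIso (X : C) : X ≅ X := ⟨-𝟙 X, -𝟙 X, by simp, by simp⟩

/-- Three rotations negate all three maps; the automorphism `-1` of the third vertex removes two of
the signs. -/
theorem neg_shift_distinguished {X Y Z : C} {f : X ⟶ Y} {g : Y ⟶ Z} {h : Z ⟶ X⟦(1 : ℤ)⟧}
    (T : Triangle.mk f g h ∈ distTriang C) :
    Triangle.mk (-f⟦(1 : ℤ)⟧') (g⟦(1 : ℤ)⟧') (h⟦(1 : ℤ)⟧') ∈ distTriang C := by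
  rw [rotate_distinguished_iff, rotate_distinguished_iff, rotate_distinguished_iff] at T
  exact distinguished_of_iso T (Iso.refl _) (Iso.refl _) (negIso _) (by simp) (by simp [negIso])
    (by simp [negIso])

theorem homCone_iff_nonempty_iso {X Y Z : C} {f : X ⟶ Y} {g : Y ⟶ Z} {h : Z ⟶ X⟦(1 : ℤ)⟧}
    (T : Triangle.mk f g h ∈ distTriang C) (V : C) :
    f ∈ homCone X Y V ↔ Nonempty (Z ≅ V) := by
  constructor
  · rintro ⟨a, b, H⟩
    exact ⟨Triangle.π₃.mapIso (isoTriangleOfIso₁₂ _ _ T H (Iso.refl _) (Iso.refl _)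
      ((Category.comp_id _).trans (Category.id_comp _).symm))⟩
  · rintro ⟨e⟩
    have := homCone_mem (Iso.refl X) (Iso.refl Y) e ⟨g, h, T⟩
    simpa using this

theorem biprod_snd_distinguished (X Y : C) :
    Triangle.mk (biprod.snd : X ⊞ Y ⟶ Y) (0 : Y ⟶ X⟦(1 : ℤ)⟧)
      (-(biprod.inl : X ⟶ X ⊞ Y)⟦(1 : ℤ)⟧') ∈ distTriang C :=
  rot_of_distTriang _ (binaryBiproductTriangle_distinguished X Y)

theorem biprod_fst_distinguished (X Y : C) :
    Triangle.mk (biprod.fst : X ⊞ Y ⟶ X) (0 : X ⟶ Y⟦(1 : ℤ)⟧)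
      (-(biprod.inr : Y ⟶ X ⊞ Y)⟦(1 : ℤ)⟧') ∈ distTriang C := by
  refine distinguished_of_iso (biprod_snd_distinguished Y X) (biprod.braiding X Y) (Iso.refl _)
    (Iso.refl _) (by simp) (by simp) ?_
  have h : biprod.inr ≫ (biprod.braiding X Y).hom = biprod.inl := by ext <;> simp
  rw [Preadditive.neg_comp, ← Functor.map_comp, h]
  simp

/-- A shear automorphism of `Z ⊞ X` preserves the cone. This is the action of `φ` on both sides of a
square at once. -/
theorem homotopyCartesian_add {A Z X W : C} {v : A ⟶ Z} {n : A ⟶ X} {a : Z ⟶ W}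
    {b : X ⟶ W} {d : W ⟶ A⟦(1 : ℤ)⟧}
    (T : Triangle.mk (biprod.lift v n) (biprod.desc a b) d ∈ distTriang C) (φ : Z ⟶ X) :
    Triangle.mk (biprod.lift v (n + v ≫ φ)) (biprod.desc (a - φ ≫ b) b) d ∈ distTriang C := by
  refine distinguished_of_iso T (Iso.refl _)
    ⟨biprod.lift biprod.fst (biprod.snd - biprod.fst ≫ φ),
      biprod.lift biprod.fst (biprod.snd + biprod.fst ≫ φ), ?_, ?_⟩ (Iso.refl _) ?_ ?_ ?_
  · ext <;> simp
  · ext <;> simp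
  · ext <;> simp
  · ext <;> simp [sub_eq_add_neg]
  · simp

theorem exists_extension_iff {Y A Z : C} {u : Y ⟶ A} {v : A ⟶ Z} {l : Z ⟶ Y⟦(1 : ℤ)⟧}
    (T : Triangle.mk u v l ∈ distTriang C) {V : C} (m : Y ⟶ V) :
    (∃ n : A ⟶ V, u ≫ n = m) ↔ l ≫ m⟦(1 : ℤ)⟧' = 0 := by
  constructor
  · rintro ⟨n, rfl⟩
    have h : l ≫ u⟦(1 : ℤ)⟧' = 0 := comp_distTriang_mor_zero₃₁ _ T
    rw [Functor.map_comp, reassoc_of% h, zero_comp]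
  · intro h
    obtain ⟨n', hn'⟩ := Triangle.yoneda_exact₃ _ (rotate_distinguished_iff.1 T) (m⟦(1 : ℤ)⟧') h
    obtain ⟨n : A ⟶ V, rfl⟩ := (shiftFunctor C (1 : ℤ)).map_surjective n'
    -- The sign compensates for the map `-u[1]` in the rotated triangle.
    refine ⟨-n, (shiftFunctor C (1 : ℤ)).map_injective ?_⟩
    have hn' : m⟦(1 : ℤ)⟧' = (-u⟦(1 : ℤ)⟧') ≫ n⟦(1 : ℤ)⟧' := hn'
    simp [hn']

variable [IsTriangulated C]

/-- Parallel morphisms of a homotopy cartesian square have the same cones. -/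
theorem homCone_iff_of_homotopyCartesian {A Z X W : C} {v : A ⟶ Z} {n : A ⟶ X} {a : Z ⟶ W}
    {b : X ⟶ W} {d : W ⟶ A⟦(1 : ℤ)⟧}
    (T : Triangle.mk (biprod.lift v n) (biprod.desc a b) d ∈ distTriang C) (V : C) :
    n ∈ homCone A X V ↔ a ∈ homCone Z W V := by
  obtain ⟨N, r, s, hN⟩ := distinguished_cocone_triangle n
  -- The octahedron on `n = (v, n) ≫ snd` gives a triangle `W → N → Z[1]` with third map `-a[1]`, so
  -- the cone `N` of `n` is also a cone of `a`.
  obtain ⟨o⟩ := IsTriangulated.octahedron_axiom (biprod.lift_snd v n) T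
    (biprod_snd_distinguished Z X) hN
  have H : Triangle.mk a o.m₁ o.m₃ ∈ distTriang C := by
    have h := o.mem
    rw [Preadditive.neg_comp, ← Functor.map_comp, biprod.inl_desc] at h
    exact rotate_distinguished_iff.2 h
  rw [homCone_iff_nonempty_iso hN, homCone_iff_nonempty_iso H]

/-- The third vertex of a homotopy cartesian square built from an extension `n` of `m` along `u`. -/
theorem exists_homotopyCartesian {X L Y A Z : C} {f : X ⟶ L} {g : L ⟶ Y} {m : Y ⟶ X⟦(1 : ℤ)⟧}
    {u : Y ⟶ A} {v : A ⟶ Z} {l : Z ⟶ Y⟦(1 : ℤ)⟧} (T₁ : Triangle.mk f g m ∈ distTriang C)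
    (T₂ : Triangle.mk u v l ∈ distTriang C) {n : A ⟶ X⟦(1 : ℤ)⟧} (hn : u ≫ n = m) :
    ∃ (a : Z ⟶ L⟦(1 : ℤ)⟧) (d : L⟦(1 : ℤ)⟧ ⟶ A⟦(1 : ℤ)⟧), a ≫ g⟦(1 : ℤ)⟧' = l ∧
      Triangle.mk (biprod.lift v n) (biprod.desc a (-f⟦(1 : ℤ)⟧')) d ∈ distTriang C := by
  obtain ⟨W, p, d, hW⟩ := distinguished_cocone_triangle (biprod.lift v n)
  -- The octahedron on `v = (v, n) ≫ fst` gives a triangle `W → Y[1] → X[2]` whose second map is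
  -- `m[1]`; comparison with the shifted triangle of `m` identifies `W` with `L[1]`.
  obtain ⟨o⟩ := IsTriangulated.octahedron_axiom (biprod.lift_fst v n) hW
    (biprod_fst_distinguished Z (X⟦(1 : ℤ)⟧)) (rotate_distinguished_iff.1 T₂)
  have h₁ : p ≫ o.m₁ = biprod.fst ≫ l := o.comm₁
  have h₃ : o.m₃ = m⟦(1 : ℤ)⟧' := by
    have h₄ := o.comm₄ =≫ (biprod.snd : Z ⊞ X⟦(1 : ℤ)⟧ ⟶ _)⟦(1 : ℤ)⟧'
    simp only [Category.assoc, Preadditive.neg_comp, Preadditive.comp_neg, ← Functor.map_comp,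
      biprod.lift_snd, biprod.inr_snd, hn, neg_inj] at h₄
    simpa using h₄.symm
  have H : Triangle.mk (biprod.inr ≫ p) o.m₁ (m⟦(1 : ℤ)⟧') ∈ distTriang C := by
    have h := o.mem
    rw [Preadditive.neg_comp, ← Functor.map_comp, h₃] at h
    exact rotate_distinguished_iff.2 h
  let e := isoTriangleOfIso₁₃ _ _ H (neg_shift_distinguished T₁) (Iso.refl _) (Iso.refl _)
    (show m⟦(1 : ℤ)⟧' ≫ (𝟙 (X⟦(1 : ℤ)⟧))⟦(1 : ℤ)⟧' = 𝟙 (Y⟦(1 : ℤ)⟧) ≫ m⟦(1 : ℤ)⟧' by simp)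
  let e₂ : W ≅ L⟦(1 : ℤ)⟧ := Triangle.π₂.mapIso e
  have c₁ : (biprod.inr ≫ p) ≫ e₂.hom = -f⟦(1 : ℤ)⟧' :=
    e.hom.comm₁.trans (Category.id_comp _)
  have c₂ : o.m₁ = e₂.hom ≫ g⟦(1 : ℤ)⟧' := (Category.comp_id _).symm.trans e.hom.comm₂
  refine ⟨biprod.inl ≫ p ≫ e₂.hom, e₂.inv ≫ d, ?_, ?_⟩
  · rw [Category.assoc, Category.assoc, ← c₂, h₁, biprod.inl_fst_assoc]
  · have hp : biprod.desc (biprod.inl ≫ p ≫ e₂.hom) (-f⟦(1 : ℤ)⟧') = p ≫ e₂.hom := by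
      refine biprod.hom_ext' _ _ (by simp) ?_
      rw [biprod.inr_desc, ← c₁, Category.assoc]
    rw [hp]
    exact distinguished_of_iso hW (Iso.refl _) (Iso.refl _) e₂.symm (by simp) (by simp) (by simp)

/-- Extensions `n` of `m` along `u` and lifts `a` of `l` along `g[1]` have cones in common. -/
theorem exists_lift_extension {X L Y A Z : C} {f : X ⟶ L} {g : L ⟶ Y} {m : Y ⟶ X⟦(1 : ℤ)⟧}
    {u : Y ⟶ A} {v : A ⟶ Z} {l : Z ⟶ Y⟦(1 : ℤ)⟧} (T₁ : Triangle.mk f g m ∈ distTriang C)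
    (T₂ : Triangle.mk u v l ∈ distTriang C) {n : A ⟶ X⟦(1 : ℤ)⟧} (hn : u ≫ n = m) :
    ∃ a : Z ⟶ L⟦(1 : ℤ)⟧, a ≫ g⟦(1 : ℤ)⟧' = l ∧ ∀ (φ : Z ⟶ X⟦(1 : ℤ)⟧) (V : C),
      (n + v ≫ φ ∈ homCone A (X⟦(1 : ℤ)⟧) V ↔
        a + φ ≫ f⟦(1 : ℤ)⟧' ∈ homCone Z (L⟦(1 : ℤ)⟧) V) := by
  obtain ⟨a, d, ha, T⟩ := exists_homotopyCartesian T₁ T₂ hn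
  refine ⟨a, ha, fun φ V => ?_⟩
  rw [homCone_iff_of_homotopyCartesian (homotopyCartesian_add T φ)]
  simp

end Triangulated

/-! ### Counting in finite groups and alternating products -/

section Counting

theorem exists_equiv_range_prod_ker {H G : Type*} [AddCommGroup H] [AddCommGroup G] (α : H →+ G) :
    ∃ e : H ≃ Set.range α × α.ker, ∀ x, ((e x).1 : G) = α x := by
  choose s hs using fun r : Set.range α => r.2
  refine ⟨⟨fun x => (⟨α x, x, rfl⟩, ⟨x - s ⟨α x, x, rfl⟩, by simp [AddMonoidHom.mem_ker, hs]⟩),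
    fun p => p.2.1 + s p.1, fun x => by simp, ?_⟩, fun x => rfl⟩
  rintro ⟨⟨r, hr⟩, ⟨y, hy⟩⟩
  have h : α (y + s ⟨r, hr⟩) = r := by rw [map_add, (AddMonoidHom.mem_ker).1 hy, hs, zero_add]
  simp [h]

theorem card_eq_card_range_mul_card_ker {H G : Type*} [AddCommGroup H] [AddCommGroup G]
    (α : H →+ G) : Nat.card H = Nat.card (Set.range α) * Nat.card α.ker := by
  obtain ⟨e, -⟩ := exists_equiv_range_prod_ker α
  rw [Nat.card_congr e, Nat.card_prod]

theorem card_subtype_comp {H G : Type*} [AddCommGroup H] [AddCommGroup G] (α : H →+ G)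
    (p : G → Prop) :
    Nat.card {x // p (α x)} = Nat.card {r : Set.range α // p r} * Nat.card α.ker := by
  obtain ⟨e, he⟩ := exists_equiv_range_prod_ker α
  rw [← Nat.card_prod]
  refine Nat.card_congr ((e.subtypeEquiv (q := fun y => p y.1) fun x => by rw [he]).trans
    ⟨fun y => (⟨y.1.1, y.2⟩, y.1.2), fun y => ⟨(y.1.1, y.2), y.1.2⟩, fun _ => rfl, fun _ => rfl⟩)

/-- Two orbits of the same finite group on which a property corresponds contain the same
proportion of elements with that property. -/
theorem card_orbit_mul_card_range {H G G' : Type*} [AddCommGroup H] [AddCommGroup G]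
    [AddCommGroup G'] [Finite H] (α : H →+ G) (β : H →+ G') (p : G → Prop) (q : G' → Prop)
    (h : ∀ x, p (α x) ↔ q (β x)) :
    Nat.card {r : Set.range α // p r} * Nat.card (Set.range β) =
      Nat.card {r : Set.range β // q r} * Nat.card (Set.range α) := by
  have h₁ := card_subtype_comp α p
  have h₂ := card_subtype_comp β q
  rw [Nat.card_congr (Equiv.subtypeEquivRight h), h₂] at h₁
  have h₃ := card_eq_card_range_mul_card_ker α
  rw [card_eq_card_range_mul_card_ker β] at h₃
  have ha : 0 < Nat.card α.ker := Nat.card_pos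
  have hb : 0 < Nat.card β.ker := Nat.card_pos
  refine Nat.eq_of_mul_eq_mul_right (Nat.mul_pos ha hb) ?_
  calc _ = (Nat.card {r : Set.range α // p r} * Nat.card α.ker) *
        (Nat.card (Set.range β) * Nat.card β.ker) := by ring
    _ = _ := by rw [← h₁, h₃]; ring

/-- Each `t (i + 1)` occurs in two consecutive factors with opposite exponents, so only `t 0`
survives. -/
theorem finprod_alternating_telescope {t : ℕ → ℚ} (ht : ∀ i, t i ≠ 0)
    {N : ℕ} (hN : ∀ i, N ≤ i → t i = 1) :
    ∏ᶠ i : ℕ, (t i * t (i + 1)) ^ ((-1 : ℤ) ^ (i + 1)) = (t 0)⁻¹ := by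
  rw [finprod_eq_prod_of_mulSupport_subset (s := Finset.range N)]
  · have key : ∀ n : ℕ, ∏ i ∈ Finset.range n, (t i * t (i + 1)) ^ ((-1 : ℤ) ^ (i + 1)) =
        (t 0)⁻¹ * t n ^ ((-1 : ℤ) ^ n) := by
      intro n
      induction n with
      | zero => simp [ht 0]
      | succ n ih =>
        rw [Finset.prod_range_succ, ih, mul_zpow, mul_assoc, ← mul_assoc (t n ^ _), pow_succ,
          mul_neg_one, zpow_neg, mul_inv_cancel₀ (zpow_ne_zero _ (ht n)), one_mul]
    rw [key, hN N le_rfl, one_zpow, mul_one]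
  · intro i hi
    by_contra h
    have hi' : N ≤ i := by simpa using h
    exact hi (by simp [hN i hi', hN (i + 1) (by omega)])

/-- The alternating product `∏ a_{i+1} ^ ((-1) ^ (i+1))`. -/
def altProd (a : ℕ → ℚ) : ℚ := ∏ᶠ i : ℕ, a (i + 1) ^ ((-1 : ℤ) ^ (i + 1))

theorem hasFiniteMulSupport_altProd {a : ℕ → ℚ} {N : ℕ} (hN : ∀ i, N ≤ i → a i = 1) :
    Function.HasFiniteMulSupport fun i : ℕ => a (i + 1) ^ ((-1 : ℤ) ^ (i + 1)) := by
  refine (Finset.range N).finite_toSet.subset fun i hi => ?_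
  by_contra h
  have hi' : N ≤ i := by simpa using h
  exact hi (by simp [hN (i + 1) (by omega)])

theorem altProd_ne_zero {a : ℕ → ℚ} (h : ∀ i, a i ≠ 0) : altProd a ≠ 0 :=
  finprod_induction (· ≠ 0) one_ne_zero (fun _ _ => mul_ne_zero) fun _ => zpow_ne_zero _ (h _)

/-- The order `q 0` of an image, in terms of the orders of the terms of the long exact sequence
that continues to the left of it. -/
theorem eq_mul_altProd {x y l q : ℕ → ℚ} (hy : ∀ i, y i ≠ 0)
    (hl : ∀ i, l i ≠ 0) (hq : ∀ i, q i ≠ 0) {N : ℕ} (hx1 : ∀ i, N ≤ i → x i = 1)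
    (hy1 : ∀ i, N ≤ i → y i = 1) (hl1 : ∀ i, N ≤ i → l i = 1) (hq1 : ∀ i, N ≤ i → q i = 1)
    (h : ∀ i, y i * l (i + 1) = q i * q (i + 1) * x (i + 1)) :
    q 0 = y 0 * (altProd x * altProd y) * (altProd l)⁻¹ := by
  -- By `h`, the product of consecutive terms `y i / q i` is `x (i + 1) * y (i + 1) / l (i + 1)`.
  have key := finprod_alternating_telescope (t := fun i => y i / q i)
    (fun i => div_ne_zero (hy i) (hq i)) (N := N) fun i hi => by simp [hy1 i hi, hq1 i hi]
  have e : ∏ᶠ i : ℕ, (y i / q i * (y (i + 1) / q (i + 1))) ^ ((-1 : ℤ) ^ (i + 1)) =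
      altProd x * altProd y * (altProd l)⁻¹ := by
    unfold altProd
    rw [← finprod_inv_distrib, ← finprod_mul_distrib (hasFiniteMulSupport_altProd hx1)
      (hasFiniteMulSupport_altProd hy1), ← finprod_mul_distrib]
    · refine finprod_congr fun i => ?_
      rw [← mul_zpow, ← inv_zpow, ← mul_zpow]
      congr 1
      have := hq i
      have := hq (i + 1)
      have := hl (i + 1)
      field_simp
      linear_combination y (i + 1) * h i
    · exact (hasFiniteMulSupport_altProd hx1).mul (hasFiniteMulSupport_altProd hy1)
    · exact (hasFiniteMulSupport_altProd hl1).inv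
  rw [mul_assoc, ← e, key]
  have := hy 0
  field_simp

end Counting

/-! ### Orders of Hom sets and of images under composition -/

section Orders

theorem card_range_congr {A B A' B' : Type*} {f : A → B} {f' : A' → B'} (a : A ≃ A') (b : B ≃ B')
    (h : ∀ x, b (f x) = f' (a x)) : Nat.card (Set.range f) = Nat.card (Set.range f') := by
  have : Set.range f' = b '' Set.range f := by
    rw [← Set.range_comp, ← a.surjective.range_comp]
    exact congrArg Set.range (funext fun x => (h x).symm)
  rw [this, Nat.card_image_of_injective b.injective]

theorem card_eq_of_exact {A B D : Type*} [AddCommGroup A] [AddCommGroup B] [AddCommGroup D]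
    (α : A →+ B) (β : B →+ D) (h : ∀ b, β b = 0 ↔ b ∈ Set.range α) :
    Nat.card B = Nat.card (Set.range β) * Nat.card (Set.range α) := by
  rw [card_eq_card_range_mul_card_ker β]
  congr 1
  exact Nat.card_congr (Equiv.subtypeEquivRight h)

variable {C : Type*} [Category C]

/-- The number of morphisms to `V` that factor through `f`. -/
def preCard {X Y : C} (f : X ⟶ Y) (V : C) : ℕ :=
  Nat.card (Set.range fun n : Y ⟶ V => f ≫ n)

/-- The number of morphisms from `V` that factor through `f`. -/
def postCard (V : C) {X Y : C} (f : X ⟶ Y) : ℕ :=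
  Nat.card (Set.range fun n : V ⟶ X => n ≫ f)

theorem preCard_congr {X Y X' Y' V V' : C} {f : X ⟶ Y} {f' : X' ⟶ Y'} (e₁ : X ≅ X') (e₂ : Y ≅ Y')
    (e : V ≅ V') (w : f ≫ e₂.hom = e₁.hom ≫ f') : preCard f V = preCard f' V' := by
  refine card_range_congr (e₂.homCongr e) (e₁.homCongr e) fun n => ?_
  have w' : f' ≫ e₂.inv = e₁.inv ≫ f := by
    rw [Iso.comp_inv_eq, Category.assoc, w, Iso.inv_hom_id_assoc]
  simp [Iso.homCongr_apply, reassoc_of% w']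

theorem postCard_congr {X Y V V' : C} (f : X ⟶ Y) (e : V ≅ V') :
    postCard V f = postCard V' f :=
  card_range_congr (e.homCongr (Iso.refl _)) (e.homCongr (Iso.refl _)) fun n => by simp

theorem preCard_neg [Preadditive C] {X Y : C} (f : X ⟶ Y) (V : C) : preCard (-f) V = preCard f V :=
  card_range_congr (Equiv.refl _) (Equiv.neg _) fun n => by simp

theorem postCard_neg [Preadditive C] (V : C) {X Y : C} (f : X ⟶ Y) : postCard V (-f) = postCard V f :=
  card_range_congr (Equiv.refl _) (Equiv.neg _) fun n => by simp

theorem card_hom_congr {X X' Y Y' : C} (e : X ≅ X') (e' : Y ≅ Y') :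
    Nat.card (X ⟶ Y) = Nat.card (X' ⟶ Y') :=
  Nat.card_congr (e.homCongr e')

section Shift

variable [HasShift C ℤ]

/-- `Hom(X[i], Y) = Hom(X, Y[-i])`. -/
def homShiftEquiv (X Y : C) (i : ℤ) : (X⟦i⟧ ⟶ Y) ≃ (X ⟶ Y⟦-i⟧) :=
  (shiftEquiv C i).toAdjunction.homEquiv X Y

theorem homShiftEquiv_comp {X X' Y : C} (f : X ⟶ X') (i : ℤ) (n : X'⟦i⟧ ⟶ Y) :
    homShiftEquiv X Y i (f⟦i⟧' ≫ n) = f ≫ homShiftEquiv X' Y i n :=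
  (shiftEquiv C i).toAdjunction.homEquiv_naturality_left f n

theorem preCard_shift {X Y : C} (f : X ⟶ Y) (V : C) (i : ℤ) :
    preCard (f⟦i⟧') V = preCard f (V⟦-i⟧) :=
  card_range_congr (homShiftEquiv Y V i) (homShiftEquiv X V i) fun n => homShiftEquiv_comp f i n

/-- Moving `i` shifts to the target allows one fixed triangle to be used in every degree. -/
theorem preCard_shift_shift {X Y : C} (f : X ⟶ Y) (V : C) (i : ℤ) :
    preCard (f⟦i + 1⟧') V = preCard (f⟦(1 : ℤ)⟧') (V⟦-i⟧) := by
  rw [← preCard_shift]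
  let e := shiftFunctorAdd' C 1 i (i + 1) (add_comm _ _)
  exact preCard_congr (e.app X) (e.app Y) (Iso.refl V) (e.hom.naturality f)

theorem preCard_shift_zero {X Y : C} (f : X ⟶ Y) (V : C) :
    preCard (f⟦(0 : ℤ)⟧') V = preCard f V :=
  preCard_congr ((shiftFunctorZero C ℤ).app X) ((shiftFunctorZero C ℤ).app Y) (Iso.refl V)
    ((shiftFunctorZero C ℤ).hom.naturality f)

/-- The number of morphisms `X[i] ⟶ Y`. -/
def homCard (X Y : C) (i : ℕ) : ℚ := Nat.card (X⟦(i : ℤ)⟧ ⟶ Y)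

theorem homCard_zero (X Y : C) : homCard X Y 0 = Nat.card (X ⟶ Y) := by
  unfold homCard
  exact congrArg _ (card_hom_congr ((shiftFunctorZero C ℤ).app X) (Iso.refl Y))

theorem homCard_eq (X Y : C) (i : ℕ) : homCard X Y i = Nat.card (X ⟶ Y⟦-(i : ℤ)⟧) := by
  unfold homCard
  rw [Nat.card_congr (homShiftEquiv X Y i)]

theorem homCard_succ (X Y : C) (i : ℕ) :
    homCard X Y (i + 1) = Nat.card (X⟦(1 : ℤ)⟧ ⟶ Y⟦-(i : ℤ)⟧) := by
  unfold homCard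
  rw [← Nat.card_congr (homShiftEquiv (X⟦(1 : ℤ)⟧) Y i)]
  exact congrArg _ (card_hom_congr
    ((shiftFunctorAdd' C 1 (i : ℤ) ((i + 1 : ℕ) : ℤ) (by push_cast; ring)).app X) (Iso.refl Y))

theorem homCard_shift_succ (X Y : C) (i : ℕ) :
    homCard X (Y⟦(1 : ℤ)⟧) (i + 1) = Nat.card (X⟦(i : ℤ)⟧ ⟶ Y) := by
  unfold homCard
  rw [card_hom_congr ((shiftFunctorAdd' C (i : ℤ) 1 ((i + 1 : ℕ) : ℤ) (by push_cast; ring)).app X)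
    (Iso.refl _)]
  let F := Functor.FullyFaithful.ofFullyFaithful (shiftFunctor C (1 : ℤ))
  exact congrArg _ (Nat.card_congr F.homEquiv.symm)

theorem postCard_shift_succ (V : C) {X Y : C} (f : X ⟶ Y) (i : ℕ) :
    postCard (V⟦((i + 1 : ℕ) : ℤ)⟧) (f⟦(1 : ℤ)⟧') = postCard (V⟦(i : ℤ)⟧) f := by
  rw [postCard_congr (f⟦(1 : ℤ)⟧')
    ((shiftFunctorAdd' C (i : ℤ) 1 ((i + 1 : ℕ) : ℤ) (by push_cast; ring)).app V)]
  let F := Functor.FullyFaithful.ofFullyFaithful (shiftFunctor C (1 : ℤ))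
  exact (card_range_congr F.homEquiv F.homEquiv fun n => (shiftFunctor C (1 : ℤ)).map_comp n f).symm

theorem brace_eq_altProd (X Y : C) : brace X Y = altProd (homCard X Y) := rfl

end Shift

/-- Finiteness of the Hom sets, and their triviality on large shifts of the source. -/
class HomFinite (C : Type*) [Category C] [HasShift C ℤ] : Prop where
  finite (X Y : C) : Finite (X ⟶ Y)
  bounded (X Y : C) : ∃ N : ℕ, ∀ i : ℕ, N ≤ i → Subsingleton (X⟦(i : ℤ)⟧ ⟶ Y)

attribute [instance] HomFinite.finite

variable [HasShift C ℤ] [Preadditive C]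

theorem homFinite_of_leftHomologicallyFinite (k : Type*) [Field k] [Finite k] [HasZeroObject C]
    [Linear k C] [∀ n : ℤ, (shiftFunctor C n).Additive] [Pretriangulated C]
    [LeftHomologicallyFinite k C] : HomFinite C where
  finite X Y := by
    have : Module.Finite k (X ⟶ Y) := LeftHomologicallyFinite.finite_hom X Y
    exact Module.finite_of_finite k
  bounded X Y := by
    obtain ⟨N, hN⟩ := (LeftHomologicallyFinite.finite_shift (k := k) X Y).bddAbove
    refine ⟨N + 1, fun i hi => ?_⟩
    have : Module.Finite k (X⟦(i : ℤ)⟧ ⟶ Y) := LeftHomologicallyFinite.finite_hom _ _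
    rw [← Module.finrank_zero_iff (R := k)]
    by_contra h
    have := hN (Function.mem_support.2 h)
    omega

theorem homCard_biprod [HasBinaryBiproducts C] (X Y Z : C) (i : ℕ) :
    homCard (X ⊞ Y) Z i = homCard X Z i * homCard Y Z i := by
  rw [homCard_eq, homCard_eq, homCard_eq, ← Nat.cast_mul, ← Nat.card_prod]
  refine congrArg _ (Nat.card_congr ⟨fun f => (biprod.inl ≫ f, biprod.inr ≫ f),
    fun p => biprod.desc p.1 p.2, fun f => ?_, fun p => ?_⟩)
  · ext <;> simp
  · simp

section Finite

variable [HomFinite C]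

theorem homCard_ne_zero (X Y : C) (i : ℕ) : homCard X Y i ≠ 0 :=
  Nat.cast_ne_zero.2 (Nat.card_pos (α := X⟦(i : ℤ)⟧ ⟶ Y)).ne'

theorem brace_ne_zero (X Y : C) : brace X Y ≠ 0 :=
  altProd_ne_zero (homCard_ne_zero X Y)

theorem eventually_homCard_eq_one (X Y : C) : ∀ᶠ i in Filter.atTop, homCard X Y i = 1 := by
  obtain ⟨N, hN⟩ := HomFinite.bounded X Y
  filter_upwards [Filter.eventually_ge_atTop N] with i hi
  have := hN i hi
  unfold homCard
  rw [Nat.card_eq_one_iff_unique.2 ⟨this, ⟨0⟩⟩, Nat.cast_one]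

theorem preCard_pos {X Y : C} (f : X ⟶ Y) (V : C) : 0 < preCard f V :=
  Nat.card_pos (α := Set.range fun n : Y ⟶ V => f ≫ n)

theorem postCard_pos (V : C) {X Y : C} (f : X ⟶ Y) : 0 < postCard V f :=
  Nat.card_pos (α := Set.range fun n : V ⟶ X => n ≫ f)

theorem eventually_preCard_eq_one {X Y : C} (f : X ⟶ Y) (V : C) :
    ∀ᶠ i : ℕ in Filter.atTop, (preCard (f⟦(i : ℤ)⟧') V : ℚ) = 1 := by
  obtain ⟨N, hN⟩ := HomFinite.bounded X V
  filter_upwards [Filter.eventually_ge_atTop N] with i hi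
  have := hN i hi
  unfold preCard
  rw [Nat.card_eq_one_iff_unique.2 ⟨inferInstance, ⟨_, 0, rfl⟩⟩, Nat.cast_one]

theorem eventually_postCard_eq_one (V : C) {X Y : C} (f : X ⟶ Y) :
    ∀ᶠ i : ℕ in Filter.atTop, (postCard (V⟦(i : ℤ)⟧) f : ℚ) = 1 := by
  obtain ⟨N, hN⟩ := HomFinite.bounded V Y
  filter_upwards [Filter.eventually_ge_atTop N] with i hi
  have := hN i hi
  unfold postCard
  rw [Nat.card_eq_one_iff_unique.2 ⟨inferInstance, ⟨_, 0, rfl⟩⟩, Nat.cast_one]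

theorem brace_biprod [HasBinaryBiproducts C] (X Y Z : C) :
    brace (X ⊞ Y) Z = brace X Z * brace Y Z := by
  obtain ⟨N, hN⟩ := Filter.eventually_atTop.1 (eventually_homCard_eq_one X Z)
  obtain ⟨M, hM⟩ := Filter.eventually_atTop.1 (eventually_homCard_eq_one Y Z)
  rw [brace_eq_altProd, brace_eq_altProd, brace_eq_altProd]
  unfold altProd
  rw [← finprod_mul_distrib (hasFiniteMulSupport_altProd hN) (hasFiniteMulSupport_altProd hM)]
  exact finprod_congr fun i => by rw [homCard_biprod, mul_zpow]

end Finite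

/-! ### Image orders from long exact sequences -/

section Triangle

variable [HasZeroObject C] [∀ n : ℤ, (shiftFunctor C n).Additive] [Pretriangulated C]
  {X L Y : C} {f : X ⟶ L} {g : L ⟶ Y} {h : Y ⟶ X⟦(1 : ℤ)⟧}

theorem card_hom_eq_preCard_mul (T : Triangle.mk f g h ∈ distTriang C) (V : C) :
    Nat.card (L ⟶ V) = preCard f V * preCard g V := by
  refine card_eq_of_exact (Preadditive.leftComp V g) (Preadditive.leftComp V f) fun n => ⟨?_, ?_⟩
  · intro hn
    obtain ⟨n', hn'⟩ := Triangle.yoneda_exact₂ _ T n hn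
    exact ⟨n', hn'.symm⟩
  · rintro ⟨n', rfl⟩
    have : f ≫ g = 0 := comp_distTriang_mor_zero₁₂ _ T
    change f ≫ g ≫ n' = 0
    rw [reassoc_of% this, zero_comp]

theorem card_hom_eq_postCard_mul (T : Triangle.mk f g h ∈ distTriang C) (V : C) :
    Nat.card (V ⟶ L) = postCard V g * postCard V f := by
  refine card_eq_of_exact (Preadditive.rightComp V f) (Preadditive.rightComp V g)
    fun n => ⟨?_, ?_⟩
  · intro hn
    obtain ⟨n', hn'⟩ := Triangle.coyoneda_exact₂ _ T n hn
    exact ⟨n', hn'.symm⟩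
  · rintro ⟨n', rfl⟩
    have : f ≫ g = 0 := comp_distTriang_mor_zero₁₂ _ T
    change (n' ≫ f) ≫ g = 0
    rw [Category.assoc, this, comp_zero]

/-- Each Hom order is a product of two consecutive image orders; those of `h` and `f[1]` cancel
against `Hom(X[1], V)`. -/
theorem card_mul_card_eq_preCard (T : Triangle.mk f g h ∈ distTriang C) (V : C) :
    Nat.card (Y ⟶ V) * Nat.card (L⟦(1 : ℤ)⟧ ⟶ V) =
      preCard g V * preCard (g⟦(1 : ℤ)⟧') V * Nat.card (X⟦(1 : ℤ)⟧ ⟶ V) := by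
  have T₁ := rotate_distinguished_iff.1 T
  have T₂ := rotate_distinguished_iff.1 T₁
  have T₃ := rotate_distinguished_iff.1 T₂
  rw [card_hom_eq_preCard_mul T₁, card_hom_eq_preCard_mul T₂, card_hom_eq_preCard_mul T₃,
    preCard_neg, preCard_neg]
  ring

theorem card_mul_card_eq_postCard (T : Triangle.mk f g h ∈ distTriang C) (V : C) :
    Nat.card (V ⟶ X⟦(1 : ℤ)⟧) * Nat.card (V ⟶ L) =
      postCard V (f⟦(1 : ℤ)⟧') * postCard V f * Nat.card (V ⟶ Y) := by
  have T₁ := rotate_distinguished_iff.1 T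
  have T₂ := rotate_distinguished_iff.1 T₁
  rw [card_hom_eq_postCard_mul T, card_hom_eq_postCard_mul T₁, card_hom_eq_postCard_mul T₂,
    postCard_neg]
  ring

/-- The order of the fibres of the precomposition with `f`. -/
theorem card_fiber_comp (T : Triangle.mk f g h ∈ distTriang C) {V : C} (n₀ : L ⟶ V) :
    Nat.card {n : L ⟶ V // f ≫ n = f ≫ n₀} = preCard g V := by
  refine (Nat.card_congr (Equiv.subtypeEquiv (Equiv.addRight n₀) fun n => ?_)).symm
  change n ∈ Set.range (fun n' : Y ⟶ V => g ≫ n') ↔ f ≫ (n + n₀) = f ≫ n₀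
  rw [Preadditive.comp_add, add_eq_right]
  constructor
  · rintro ⟨n', rfl⟩
    have : f ≫ g = 0 := comp_distTriang_mor_zero₁₂ _ T
    simp [reassoc_of% this]
  · intro hn
    obtain ⟨n', hn'⟩ := Triangle.yoneda_exact₂ _ T n hn
    exact ⟨n', hn'.symm⟩

variable [HomFinite C]

theorem preCard_eq (T : Triangle.mk f g h ∈ distTriang C) (V : C) :
    (preCard g V : ℚ) = Nat.card (Y ⟶ V) * (brace X V * brace Y V) * (brace L V)⁻¹ := by
  obtain ⟨N, hN⟩ := Filter.eventually_atTop.1 ((eventually_homCard_eq_one X V).and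
    ((eventually_homCard_eq_one Y V).and ((eventually_homCard_eq_one L V).and
      (eventually_preCard_eq_one g V))))
  have key := eq_mul_altProd (x := homCard X V) (y := homCard Y V) (l := homCard L V)
    (q := fun i : ℕ => (preCard (g⟦(i : ℤ)⟧') V : ℚ)) (homCard_ne_zero _ _) (homCard_ne_zero _ _)
    (fun i => Nat.cast_ne_zero.2 (preCard_pos _ _).ne') (fun i hi => (hN i hi).1)
    (fun i hi => (hN i hi).2.1) (fun i hi => (hN i hi).2.2.1) (fun i hi => (hN i hi).2.2.2)
    fun i => by
      have h₁ := card_mul_card_eq_preCard T (V⟦-(i : ℤ)⟧)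
      rw [← preCard_shift, ← preCard_shift_shift] at h₁
      rw [homCard_succ, homCard_succ, homCard_eq]
      exact_mod_cast h₁
  rw [homCard_zero] at key
  rw [brace_eq_altProd, brace_eq_altProd, brace_eq_altProd, ← key]
  exact congrArg _ (preCard_shift_zero g V).symm

/-- Here the sequence is continued by shifting `V`: degree `i + 1` with target `Y[1]` is degree `i`
with target `Y`. -/
theorem postCard_eq (T : Triangle.mk f g h ∈ distTriang C) (V : C) :
    (postCard V (f⟦(1 : ℤ)⟧') : ℚ) = Nat.card (V ⟶ X⟦(1 : ℤ)⟧) *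
      (brace V (Y⟦(1 : ℤ)⟧) * brace V (X⟦(1 : ℤ)⟧)) * (brace V (L⟦(1 : ℤ)⟧))⁻¹ := by
  obtain ⟨N, hN⟩ := Filter.eventually_atTop.1 ((eventually_homCard_eq_one V (Y⟦(1 : ℤ)⟧)).and
    ((eventually_homCard_eq_one V (X⟦(1 : ℤ)⟧)).and
      ((eventually_homCard_eq_one V (L⟦(1 : ℤ)⟧)).and
        (eventually_postCard_eq_one V (f⟦(1 : ℤ)⟧')))))
  have key := eq_mul_altProd (x := homCard V (Y⟦(1 : ℤ)⟧)) (y := homCard V (X⟦(1 : ℤ)⟧))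
    (l := homCard V (L⟦(1 : ℤ)⟧)) (q := fun i : ℕ => (postCard (V⟦(i : ℤ)⟧) (f⟦(1 : ℤ)⟧') : ℚ))
    (homCard_ne_zero _ _) (homCard_ne_zero _ _)
    (fun i => Nat.cast_ne_zero.2 (postCard_pos _ _).ne') (fun i hi => (hN i hi).1)
    (fun i hi => (hN i hi).2.1) (fun i hi => (hN i hi).2.2.1) (fun i hi => (hN i hi).2.2.2)
    fun i => by
      have h₁ := card_mul_card_eq_postCard T (V⟦(i : ℤ)⟧)
      rw [← postCard_shift_succ V f] at h₁
      rw [homCard_shift_succ, homCard_shift_succ]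
      unfold homCard
      exact_mod_cast h₁
  rw [homCard_zero] at key
  rw [brace_eq_altProd, brace_eq_altProd, brace_eq_altProd, ← key]
  exact congrArg _ (postCard_congr _ ((shiftFunctorZero C ℤ).app V).symm)

end Triangle

end Orders

/-! ### Associativity -/

section Associativity

theorem card_subtype_eq_sum_fibers {A B : Type*} [Finite A] [Fintype B] (F : A → B) (p : A → Prop) :
    Nat.card {x // p x} = ∑ y, Nat.card {x // F x = y ∧ p x} := by
  rw [← Nat.card_sigma]
  exact Nat.card_congr ⟨fun x => ⟨F x, x, rfl, x.2⟩, fun s => ⟨s.2.1, s.2.2.2⟩, fun x => rfl,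
    fun ⟨_, _, rfl, _⟩ => rfl⟩

variable {C : Type*} [Category C] [HasZeroObject C] [HasShift C ℤ] [Preadditive C]
  [∀ n : ℤ, (shiftFunctor C n).Additive] [Pretriangulated C]

section Octahedral

variable [HomFinite C] [IsTriangulated C] {X L Y A Z : C} {f : X ⟶ L} {g : L ⟶ Y} {m : Y ⟶ X⟦(1 : ℤ)⟧}
  {u : Y ⟶ A} {v : A ⟶ Z} {l : Z ⟶ Y⟦(1 : ℤ)⟧}

/-- Among the lifts of `l` along `g[1]` and the extensions of `m` along `u`, the morphisms with a
given cone occur in the same proportion. -/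
theorem card_lifts_mul_preCard (T₁ : Triangle.mk f g m ∈ distTriang C)
    (T₂ : Triangle.mk u v l ∈ distTriang C) (V : C) :
    Nat.card {a : Z ⟶ L⟦(1 : ℤ)⟧ // a ≫ g⟦(1 : ℤ)⟧' = l ∧ a ∈ homCone Z (L⟦(1 : ℤ)⟧) V} *
        preCard v (X⟦(1 : ℤ)⟧) =
      Nat.card {n : A ⟶ X⟦(1 : ℤ)⟧ // u ≫ n = m ∧ n ∈ homCone A (X⟦(1 : ℤ)⟧) V} *
        postCard Z (f⟦(1 : ℤ)⟧') := by
  have T₃ := neg_shift_distinguished T₁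
  have hg : f⟦(1 : ℤ)⟧' ≫ g⟦(1 : ℤ)⟧' = 0 := by
    have : f ≫ g = 0 := comp_distTriang_mor_zero₁₂ _ T₁
    rw [← Functor.map_comp, this, Functor.map_zero]
  have hv : u ≫ v = 0 := comp_distTriang_mor_zero₁₂ _ T₂
  -- This composite obstructs both extending `m` and lifting `l`. If it vanishes, both sets are
  -- orbits of `Hom(Z, X[1])` through `n₀` and `a₀`; otherwise both are empty.
  by_cases hlm : l ≫ m⟦(1 : ℤ)⟧' = 0
  · obtain ⟨n₀, hn₀⟩ := (exists_extension_iff T₂ m).2 hlm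
    obtain ⟨a₀, ha₀, key⟩ := exists_lift_extension T₁ T₂ hn₀
    have h := card_orbit_mul_card_range (Preadditive.rightComp Z (f⟦(1 : ℤ)⟧'))
      (Preadditive.leftComp (X⟦(1 : ℤ)⟧) v) (fun r => a₀ + r ∈ homCone Z (L⟦(1 : ℤ)⟧) V)
      (fun r => n₀ + r ∈ homCone A (X⟦(1 : ℤ)⟧) V) fun φ => (key φ V).symm
    refine (congrArg₂ (· * ·) ?_ rfl).trans (h.trans (congrArg₂ (· * ·) ?_ rfl))
    · symm
      refine Nat.card_congr ⟨fun r => ⟨a₀ + r.1.1, ?_, r.2⟩, fun a => ⟨⟨a.1 - a₀, ?_⟩, ?_⟩,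
        fun r => by simp, fun a => by simp⟩
      · obtain ⟨⟨r, φ, rfl⟩, hr⟩ := r
        change (a₀ + φ ≫ f⟦(1 : ℤ)⟧') ≫ g⟦(1 : ℤ)⟧' = l
        rw [Preadditive.add_comp, ha₀, Category.assoc, hg, comp_zero, add_zero]
      · obtain ⟨φ : Z ⟶ X⟦(1 : ℤ)⟧, hφ⟩ := Triangle.coyoneda_exact₂ _ T₃ (a.1 - a₀)
          (show (a.1 - a₀) ≫ g⟦(1 : ℤ)⟧' = 0 by rw [Preadditive.sub_comp, a.2.1, ha₀, sub_self])
        refine ⟨-φ, hφ.symm ▸ ?_⟩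
        change (-φ) ≫ f⟦(1 : ℤ)⟧' = φ ≫ (-f⟦(1 : ℤ)⟧')
        rw [Preadditive.neg_comp, Preadditive.comp_neg]
      · simpa using a.2.2
    · refine Nat.card_congr ⟨fun r => ⟨n₀ + r.1.1, ?_, r.2⟩, fun n => ⟨⟨n.1 - n₀, ?_⟩, ?_⟩,
        fun r => by simp, fun n => by simp⟩
      · obtain ⟨⟨r, φ, rfl⟩, hr⟩ := r
        change u ≫ (n₀ + v ≫ φ) = m
        rw [Preadditive.comp_add, hn₀, reassoc_of% hv, zero_comp, add_zero]
      · obtain ⟨φ, hφ⟩ := Triangle.yoneda_exact₂ _ T₂ (n.1 - n₀)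
          (show u ≫ (n.1 - n₀) = 0 by rw [Preadditive.comp_sub, n.2.1, hn₀, sub_self])
        exact ⟨φ, hφ.symm⟩
      · simpa using n.2.2
  · have h₁ : IsEmpty {a : Z ⟶ L⟦(1 : ℤ)⟧ //
        a ≫ g⟦(1 : ℤ)⟧' = l ∧ a ∈ homCone Z (L⟦(1 : ℤ)⟧) V} := by
      refine ⟨fun a => hlm ?_⟩
      have h : g⟦(1 : ℤ)⟧' ≫ m⟦(1 : ℤ)⟧' = 0 := comp_distTriang_mor_zero₂₃ _ T₃
      rw [← a.2.1, Category.assoc, h, comp_zero]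
    have h₂ : IsEmpty {n : A ⟶ X⟦(1 : ℤ)⟧ //
        u ≫ n = m ∧ n ∈ homCone A (X⟦(1 : ℤ)⟧) V} :=
      ⟨fun n => hlm ((exists_extension_iff T₂ m).1 ⟨n.1, n.2.1⟩)⟩
    rw [Nat.card_of_isEmpty, Nat.card_of_isEmpty, zero_mul, zero_mul]

/-- Both orbit sizes contain `|Hom(Z, X[1])|` and `{Z, X[1]}`, which cancel and leave the four
braces of the two products. -/
theorem card_lifts_mul_brace (T₁ : Triangle.mk f g m ∈ distTriang C)
    (T₂ : Triangle.mk u v l ∈ distTriang C) (V : C) :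
    brace Y (X⟦(1 : ℤ)⟧) *
        ((Nat.card {a : Z ⟶ L⟦(1 : ℤ)⟧ //
          a ≫ g⟦(1 : ℤ)⟧' = l ∧ a ∈ homCone Z (L⟦(1 : ℤ)⟧) V} : ℚ) * brace Z (L⟦(1 : ℤ)⟧)) =
      brace Z (Y⟦(1 : ℤ)⟧) *
        ((Nat.card {n : A ⟶ X⟦(1 : ℤ)⟧ //
          u ≫ n = m ∧ n ∈ homCone A (X⟦(1 : ℤ)⟧) V} : ℚ) * brace A (X⟦(1 : ℤ)⟧)) := by
  have key := congrArg (Nat.cast : ℕ → ℚ) (card_lifts_mul_preCard T₁ T₂ V)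
  rw [Nat.cast_mul, Nat.cast_mul, preCard_eq T₂, postCard_eq T₁] at key
  have h₁ := brace_ne_zero Z (L⟦(1 : ℤ)⟧)
  have h₂ := brace_ne_zero A (X⟦(1 : ℤ)⟧)
  have h₃ := brace_ne_zero Z (X⟦(1 : ℤ)⟧)
  have h₄ : (Nat.card (Z ⟶ X⟦(1 : ℤ)⟧) : ℚ) ≠ 0 := Nat.cast_ne_zero.2 Nat.card_pos.ne'
  field_simp at key
  linear_combination key

end Octahedral

section Algebra

variable (k : Type*) [Field k] [Finite k] [Linear k C] [LeftHomologicallyFinite k C]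

theorem mul_single_single (X Y : C) :
    mul k C (Finsupp.single (isoClass X) 1) (Finsupp.single (isoClass Y) 1) = objMul k X Y := by
  simp only [mul, Finsupp.linearCombination_single, one_smul]
  rfl

variable [∀ X Y : C, Fintype (X ⟶ Y)]

/-- Summing over morphisms instead of isomorphism classes keeps a triangle available for each term.
-/
theorem objMul_eq_sum (X Y : C) (L : (Y ⟶ X⟦(1 : ℤ)⟧) → C)
    (hL : ∀ m, ∃ (f : X ⟶ L m) (g : L m ⟶ Y), Triangle.mk f g m ∈ distTriang C) :
    objMul k X Y =
      ∑ m, brace Y (X⟦(1 : ℤ)⟧) • (Finsupp.single (isoClass (L m)) 1 : Space C) := by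
  classical
  ext c
  induction c using Quotient.inductionOn with
  | h M =>
    have key : ∀ m : Y ⟶ X⟦(1 : ℤ)⟧, isoClass (L m) = isoClass M ↔
        m ∈ homCone Y (X⟦(1 : ℤ)⟧) (M⟦(1 : ℤ)⟧) := by
      intro m
      obtain ⟨f, g, T⟩ := hL m
      rw [homCone_iff_nonempty_iso (rotate_distinguished_iff.1 (rotate_distinguished_iff.1 T))]
      exact ⟨fun h => (Quotient.exact h).map fun e => (shiftFunctor C (1 : ℤ)).mapIso e,
        fun ⟨e⟩ => Quotient.sound ⟨(shiftFunctor C (1 : ℤ)).preimageIso e⟩⟩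
    change coeff X Y M = (∑ m, _ : Space C) (isoClass M)
    simp only [Finsupp.finsetSum_apply, Finsupp.smul_apply, Finsupp.single_apply, key, smul_eq_mul,
      mul_ite, mul_one, mul_zero, ← Finset.sum_filter, Finset.sum_const, nsmul_eq_mul]
    rw [coeff, Nat.card_eq_fintype_card, Fintype.card_ofFinset]

variable [HomFinite C] [IsTriangulated C]

theorem mul_assoc_single (X Y Z : C) :
    mul k C (mul k C (Finsupp.single (isoClass X) 1) (Finsupp.single (isoClass Y) 1))
        (Finsupp.single (isoClass Z) 1) =
      mul k C (Finsupp.single (isoClass X) 1)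
        (mul k C (Finsupp.single (isoClass Y) 1) (Finsupp.single (isoClass Z) 1)) := by
  choose L f g T using fun m : Y ⟶ X⟦(1 : ℤ)⟧ => distinguished_cocone_triangle₂ m
  choose A u v S using fun l : Z ⟶ Y⟦(1 : ℤ)⟧ => distinguished_cocone_triangle₂ l
  rw [mul_single_single, mul_single_single, objMul_eq_sum k X Y L fun m => ⟨_, _, T m⟩,
    objMul_eq_sum k Y Z A fun l => ⟨_, _, S l⟩]
  ext c
  induction c using Quotient.inductionOn with
  | h M =>
    change _ = (_ : Space C) (isoClass M)
    simp only [map_sum, map_smul, LinearMap.sum_apply, LinearMap.smul_apply,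
      Finsupp.finsetSum_apply, Finsupp.smul_apply, smul_eq_mul]
    have h₁ : ∀ m, mul k C (Finsupp.single (isoClass (L m)) 1) (Finsupp.single (isoClass Z) 1)
        (isoClass M) = ∑ l, (Nat.card {a : Z ⟶ (L m)⟦(1 : ℤ)⟧ // a ≫ (g m)⟦(1 : ℤ)⟧' = l ∧
          a ∈ homCone Z ((L m)⟦(1 : ℤ)⟧) (M⟦(1 : ℤ)⟧)} : ℚ) * brace Z ((L m)⟦(1 : ℤ)⟧) := by
      intro m
      rw [mul_single_apply, coeff, ← Finset.sum_mul, ← Nat.cast_sum]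
      congr 2
      exact card_subtype_eq_sum_fibers (fun a => a ≫ (g m)⟦(1 : ℤ)⟧') _
    have h₂ : ∀ l, mul k C (Finsupp.single (isoClass X) 1) (Finsupp.single (isoClass (A l)) 1)
        (isoClass M) = ∑ m, (Nat.card {n : A l ⟶ X⟦(1 : ℤ)⟧ // u l ≫ n = m ∧
          n ∈ homCone (A l) (X⟦(1 : ℤ)⟧) (M⟦(1 : ℤ)⟧)} : ℚ) * brace (A l) (X⟦(1 : ℤ)⟧) := by
      intro l
      rw [mul_single_apply, coeff, ← Finset.sum_mul, ← Nat.cast_sum]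
      congr 2
      exact card_subtype_eq_sum_fibers (fun n => u l ≫ n) _
    refine (Finset.sum_congr rfl fun m _ => congrArg _ (h₁ m)).trans
      (Eq.trans ?_ (Finset.sum_congr rfl fun l _ => congrArg _ (h₂ l)).symm)
    -- Both sides are now double sums over `(m, l)`, equal term by term.
    simp only [Finset.mul_sum]
    rw [Finset.sum_comm]
    exact Finset.sum_congr rfl fun l _ => Finset.sum_congr rfl fun m _ =>
      card_lifts_mul_brace (T m) (S l) _

theorem mul_assoc_space (a b c : Space C) :
    mul k C (mul k C a b) c = mul k C a (mul k C b c) := by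
  induction a using Finsupp.induction_linear with
  | zero => simp
  | add a a' ha ha' => simp only [map_add, LinearMap.add_apply, ha, ha']
  | single x r =>
    induction b using Finsupp.induction_linear with
    | zero => simp
    | add b b' hb hb' => simp only [map_add, LinearMap.add_apply, hb, hb']
    | single y s =>
      induction c using Finsupp.induction_linear with
      | zero => simp
      | add c c' hc hc' => simp only [map_add, hc, hc']
      | single z t =>
        induction x using Quotient.inductionOn with
        | h X =>
        induction y using Quotient.inductionOn with
        | h Y =>
        induction z using Quotient.inductionOn with
        | h Z =>
        rw [← Finsupp.smul_single_one _ r, ← Finsupp.smul_single_one _ s,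
          ← Finsupp.smul_single_one _ t]
        simp only [map_smul, LinearMap.smul_apply]
        congr 3
        exact mul_assoc_single k X Y Z

end Algebra

end Associativity

end DrinfeldHall

end

theorem mainTheorem4 {k : Type*} [Field k] [Finite k] {C : Type*} [Category C]
    [HasZeroObject C] [HasShift C ℤ] [Preadditive C] [Linear k C]
    [∀ n : ℤ, (shiftFunctor C n).Additive] [Pretriangulated C] [IsTriangulated C]
    [DrinfeldHall.LeftHomologicallyFinite k C] :
    (∀ a b c : DrinfeldHall.Space C,
      DrinfeldHall.mul k C (DrinfeldHall.mul k C a b) c =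
        DrinfeldHall.mul k C a (DrinfeldHall.mul k C b c)) ∧
    (∀ (X Y Z L L' : C) (f : X ⟶ L) (g : L ⟶ Y) (h : Y ⟶ X⟦(1 : ℤ)⟧),
      Triangle.mk f g h ∈ distTriang C →
      Set.MapsTo (fun n : L ⟶ Z⟦(1 : ℤ)⟧ => f ≫ n)
        {n | f ≫ n ∈ DrinfeldHall.homCone X (Z⟦(1 : ℤ)⟧) (L'⟦(1 : ℤ)⟧)}
        {n' | n' ∈ DrinfeldHall.homCone X (Z⟦(1 : ℤ)⟧) (L'⟦(1 : ℤ)⟧) ∧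
          h ≫ n'⟦(1 : ℤ)⟧' = 0} ∧
      Set.SurjOn (fun n : L ⟶ Z⟦(1 : ℤ)⟧ => f ≫ n)
        {n | f ≫ n ∈ DrinfeldHall.homCone X (Z⟦(1 : ℤ)⟧) (L'⟦(1 : ℤ)⟧)}
        {n' | n' ∈ DrinfeldHall.homCone X (Z⟦(1 : ℤ)⟧) (L'⟦(1 : ℤ)⟧) ∧
          h ≫ n'⟦(1 : ℤ)⟧' = 0} ∧
      ∀ n' ∈ DrinfeldHall.homCone X (Z⟦(1 : ℤ)⟧) (L'⟦(1 : ℤ)⟧),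
        h ≫ n'⟦(1 : ℤ)⟧' = 0 →
        (Nat.card {n : L ⟶ Z⟦(1 : ℤ)⟧ // f ≫ n = n'} : ℚ) =
          (Nat.card (Y ⟶ Z⟦(1 : ℤ)⟧) : ℚ) *
            DrinfeldHall.brace (X ⊞ Y) (Z⟦(1 : ℤ)⟧) *
              (DrinfeldHall.brace L (Z⟦(1 : ℤ)⟧))⁻¹) := by
  have := DrinfeldHall.homFinite_of_leftHomologicallyFinite (C := C) k
  let _ : ∀ X Y : C, Fintype (X ⟶ Y) := fun _ _ => Fintype.ofFinite _
  refine ⟨DrinfeldHall.mul_assoc_space k, fun X Y Z L L' f g h T => ⟨fun n hn => ⟨hn,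
    (DrinfeldHall.exists_extension_iff T _).1 ⟨n, rfl⟩⟩, ?_, ?_⟩⟩
  · rintro n' ⟨hn', h0⟩
    obtain ⟨n, rfl⟩ := (DrinfeldHall.exists_extension_iff T n').2 h0
    exact ⟨n, hn', rfl⟩
  · intro n' _ h0
    obtain ⟨n, rfl⟩ := (DrinfeldHall.exists_extension_iff T n').2 h0
    -- The fibre through `n` is a coset of the image of composition with `g`, whose order comes from
    -- the long exact sequence.
    rw [DrinfeldHall.card_fiber_comp T, DrinfeldHall.preCard_eq T, DrinfeldHall.brace_biprod]
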